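/- Work with quadratures $\hat x_k=\hat a_k+\hat a_k^\dagger$, $\hat p_k=i(\hat a_k^\dagger-\hat a_k)$, ordered as $(x_1,p_1,\dots,x_m,p_m)$, and let $\Omega=\bigoplus_{k=1}^m\begin{bmatrix}0&1\\-1&0\end{bmatrix}$. A zero-mean $m$-mode Gaussian state is represented by its covariance matrix, i.e. a real symmetric positive-definite $2m\times 2m$ matrix $\sigma$ with $\sigma+i\Omega\ge 0$ (the vacuum is $\mathbb 1$); it is pure iff $\det\sigma=1$. A passive operation is an orthogonal matrix $K$ with $K\Omega K^T=\Omega$; it acts by $\sigma\mapsto K\sigma K^T$. For a pure $m$-mode Gaussian state $\pi$ with eigenvalues $\lambda_1\le\dots\le\lambda_{2m}$ let $\mathcal S(\pi)=-\frac12\sum_{i=1}^m\ln\lambda_i$. The squeezing of formation of a Gaussian state $\sigma$ is $$\mathcal S(\sigma)=\inf\{\mathcal S(\pi)\;:\;\sigma=\pi+\varphi,\ \pi\text{ a pure Gaussian state},\ \varphi\ge 0\}.$$ Let $$h(x)=\frac{(1+x)^2}{4x}\log_2\frac{(1+x)^2}{4x}-\frac{(1-x)^2}{4x}\log_2\frac{(1-x)^2}{4x},$$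 with $0\log_2 0=0$. For a pure two-mode Gaussian state $\pi$, let $\nu_-(\pi^\Gamma)$ be the lowest symplectic eigenvalue (the least nonnegative eigenvalue of $i\Omega\pi^\Gamma$) of the partial transpose $\pi^\Gamma=T\pi T$, $T=\mathrm{diag}(1,1,1,-1)$. The entropy of entanglement of $\pi$ is $\mathcal E(\pi)=h[\nu_-(\pi^\Gamma)]$ if $\nu_-(\pi^\Gamma)<1$, and $\mathcal E(\pi)=0$ otherwise. The (Gaussian) entanglement of formation of a two-mode Gaussian state $\sigma$ is $$\mathcal E(\sigma)=\inf\{\mathcal E(\pi)\;:\;\sigma=\pi+\varphi,\ \pi\text{ a pure Gaussian state},\ \varphi\ge 0\}.$$ The EoF-potential of a two-mode Gaussian state $\sigma$ is $$\mathcal P(\sigma)=\sup_{n,K}\ \mathcal E\big(\mathrm{tr}_n[K(\sigma\oplus\mathbb 1_n)K^T]\big),$$ the supremum being over all numbers $n\ge 0$ of ancillary vacuum modes (with covariance matrix $\mathbb 1_n$, the $2n\times 2n$ identity) and all passive operations $K$ on $n+2$ modes; $\mathrm{tr}_n$ is the partial trace over the last $n$ modes, i.e. it keeps the upper left $4\times4$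 block. Proposition. For every two-mode Gaussian state $\sigma$, $$\mathcal P(\sigma)\le h\big[e^{-\mathcal S(\sigma)}\big].$$ -/

import Mathlib

open scoped Matrix Kronecker ComplexOrder

namespace GaussianModes

/-- Phase-space indices of a bosonic system with set of modes `m`: the index `(k, 0)` stands for the
quadrature `x_k` and `(k, 1)` for the quadrature `p_k`. -/
abbrev PhaseIdx (m : Type*) := m × Fin 2

/-- The symplectic form `Ω = ⨁_k [[0, 1], [-1, 0]]`. -/
def symplecticForm (m : Type*) [DecidableEq m] : Matrix (PhaseIdx m) (PhaseIdx m) ℝ :=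
  (1 : Matrix m m ℝ) ⊗ₖ !![0, 1; -1, 0]

section General

variable {m : Type*} [Fintype m] [DecidableEq m]

/-- `σ` is the covariance matrix `σ_ij = ½⟨{q_i, q_j}⟩` of a (zero-mean) Gaussian state of the modes
`m`: a real symmetric positive definite matrix that satisfies the uncertainty relation
`σ + iΩ ≥ 0`. The units are those of `x = a + a†`, `p = i (a† - a)`, in which the vacuum has
covariance matrix `1`. -/
structure IsGaussian (σ : Matrix (PhaseIdx m) (PhaseIdx m) ℝ) : Prop where
  posDef : σ.PosDef
  uncertainty :
    (σ.map Complex.ofReal + Complex.I • (symplecticForm m).map Complex.ofReal).PosSemidef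

/-- `π` is the covariance matrix of a pure Gaussian state. -/
structure IsPure (π : Matrix (PhaseIdx m) (PhaseIdx m) ℝ) : Prop extends IsGaussian π where
  det_eq_one : π.det = 1

/-- `K` is a passive (energy preserving) Gaussian operation: a symplectic orthogonal matrix. -/
structure IsPassive (K : Matrix (PhaseIdx m) (PhaseIdx m) ℝ) : Prop where
  symplectic : K * symplecticForm m * Kᵀ = symplecticForm m
  orthogonal : K * Kᵀ = 1

/-- The symplectic eigenvalues of a positive definite matrix `A`: the nonnegative eigenvalues of
`iΩA` (the full spectrum of `iΩA` consists of these numbers and their negatives). -/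
def symplecticEigenvalues (A : Matrix (PhaseIdx m) (PhaseIdx m) ℝ) : Set ℝ :=
  {ν | 0 ≤ ν ∧ (ν : ℂ) ∈ spectrum ℂ (Complex.I • (symplecticForm m * A).map Complex.ofReal)}

/-- The lowest symplectic eigenvalue `ν₋`. -/
noncomputable def lowestSymplecticEigenvalue (A : Matrix (PhaseIdx m) (PhaseIdx m) ℝ) : ℝ :=
  sInf (symplecticEigenvalues A)

/-- The eigenvalues of a real symmetric matrix in increasing order, with multiplicity
(`eigenvalues₀` lists them in decreasing order). -/
noncomputable def increasingEigenvalues {A : Matrix (PhaseIdx m) (PhaseIdx m) ℝ}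
    (hA : A.IsHermitian) (i : Fin (Fintype.card (PhaseIdx m))) : ℝ :=
  hA.eigenvalues₀ i.rev

/-- Squeezing of a pure Gaussian state of `n` modes: `-½ ∑ ln λ_i` over the `n` lowest of the `2n`
eigenvalues of its covariance matrix. -/
noncomputable def pureSqueezing (π : Matrix (PhaseIdx m) (PhaseIdx m) ℝ) (hπ : IsPure π) : ℝ :=
  -(1 / 2) * ∑ i : Fin (Fintype.card (PhaseIdx m)) with i.val < Fintype.card m,
    Real.log (increasingEigenvalues hπ.posDef.isHermitian i)

/-- Squeezing of formation: the infimum of the squeezing of `π` over all decompositions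
`σ = π + φ` with `π` a pure Gaussian state and `φ ≥ 0`. -/
noncomputable def squeezingOfFormation (σ : Matrix (PhaseIdx m) (PhaseIdx m) ℝ) : ℝ :=
  sInf {s | ∃ (π φ : Matrix (PhaseIdx m) (PhaseIdx m) ℝ) (hπ : IsPure π),
    φ.PosSemidef ∧ σ = π + φ ∧ s = pureSqueezing π hπ}

end General

/-- The auxiliary function `h`. -/
noncomputable def h (x : ℝ) : ℝ :=
  (1 + x) ^ 2 / (4 * x) * Real.logb 2 ((1 + x) ^ 2 / (4 * x))
    - (1 - x) ^ 2 / (4 * x) * Real.logb 2 ((1 - x) ^ 2 / (4 * x))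

/-- Partial transposition of a two-mode state, on covariance matrices: the sign of the momentum
quadrature of the second mode is reversed. -/
def partialTranspose (A : Matrix (PhaseIdx (Fin 2)) (PhaseIdx (Fin 2)) ℝ) :
    Matrix (PhaseIdx (Fin 2)) (PhaseIdx (Fin 2)) ℝ :=
  Matrix.diagonal (fun k => if k = (1, 1) then -1 else 1) * A *
    Matrix.diagonal (fun k => if k = (1, 1) then -1 else 1)

/-- Entropy of entanglement (between the two modes) of a pure two-mode Gaussian state `π`. -/
noncomputable def entanglementEntropy (π : Matrix (PhaseIdx (Fin 2)) (PhaseIdx (Fin 2)) ℝ) : ℝ :=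
  if lowestSymplecticEigenvalue (partialTranspose π) < 1 then
    h (lowestSymplecticEigenvalue (partialTranspose π))
  else 0

/-- Gaussian entanglement of formation of a two-mode state: the infimum of the entropy of
entanglement of `π` over all decompositions `σ = π + φ` with `π` a pure Gaussian state and `φ ≥ 0`.
It is taken in the extended reals, where no convention for empty or unbounded sets interferes. -/
noncomputable def entanglementOfFormation
    (σ : Matrix (PhaseIdx (Fin 2)) (PhaseIdx (Fin 2)) ℝ) : EReal :=
  sInf {e | ∃ π φ : Matrix (PhaseIdx (Fin 2)) (PhaseIdx (Fin 2)) ℝ,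
    IsPure π ∧ φ.PosSemidef ∧ σ = π + φ ∧ e = (entanglementEntropy π : EReal)}

/-- `σ ⊕ 1_n`: the state `σ` of two modes together with `n` ancillary modes in the vacuum. -/
def withVacuum (σ : Matrix (PhaseIdx (Fin 2)) (PhaseIdx (Fin 2)) ℝ) (n : ℕ) :
    Matrix (PhaseIdx (Fin 2 ⊕ Fin n)) (PhaseIdx (Fin 2 ⊕ Fin n)) ℝ :=
  (Matrix.fromBlocks σ 0 0 1).submatrix
    (Equiv.sumProdDistrib (Fin 2) (Fin n) (Fin 2)) (Equiv.sumProdDistrib (Fin 2) (Fin n) (Fin 2))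

/-- Partial trace over the last `n` modes: the block of the covariance matrix that belongs to the
first two modes. -/
def traceOut {n : ℕ} (A : Matrix (PhaseIdx (Fin 2 ⊕ Fin n)) (PhaseIdx (Fin 2 ⊕ Fin n)) ℝ) :
    Matrix (PhaseIdx (Fin 2)) (PhaseIdx (Fin 2)) ℝ :=
  A.submatrix (fun k => (Sum.inl k.1, k.2)) (fun k => (Sum.inl k.1, k.2))

/-- EoF-potential: the supremum, over all numbers `n` of vacuum ancillas and all passive operations
`K` on the `n + 2` modes, of the entanglement of formation of `tr_n [K (σ ⊕ 1_n) Kᵀ]`. -/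
noncomputable def eofPotential (σ : Matrix (PhaseIdx (Fin 2)) (PhaseIdx (Fin 2)) ℝ) : EReal :=
  sSup {e | ∃ (n : ℕ) (K : Matrix (PhaseIdx (Fin 2 ⊕ Fin n)) (PhaseIdx (Fin 2 ⊕ Fin n)) ℝ),
    IsPassive K ∧ e = entanglementOfFormation (traceOut (K * withVacuum σ n * Kᵀ))}

end GaussianModes

/-!
A decomposition `σ = π + φ` with `π` pure bounds the entanglement of formation of every state that
is obtained from `σ` with vacuum ancillas and passive operations, because squeezing is monotone.
Write `λ₁ ≤ λ₂` for the two lowest eigenvalues of `π`, so that `exp (-S(π)) = √(λ₁ λ₂)`. Up to a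
positive semidefinite summand that comes from `φ`, the output state is a compression `W Q Wᵀ` of the
symplectic matrix `Q = π ⊕ 1` by a coisometry `W` that intertwines the symplectic forms. Three facts
then combine.

* Compression. Let `π'` be the pure state whose Cayley transform is the compression of the Cayley
  transform of `Q`, that is `(π' + 1)⁻¹ = W (Q + 1)⁻¹ Wᵀ`. Operator convexity of the inverse gives
  `π' ≤ W Q Wᵀ`, and min-max shows that the two lowest eigenvalues of `π'` are at least `λ₁`
  and `λ₂` (`exists_isPure_le_compression`). That the vacuum eigenvalue `1` does not interfere
  requires `λ₂ ≤ 1`, which holds as `π⁻¹ = Ωᵀ π Ω` (`IsPure.le_one_of_formBound`).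
* Entanglement. The lowest symplectic eigenvalue of the partial transpose of `π'` is at least
  `√(λ₁ λ₂)` (`sqrt_le_of_mem_symplecticEigenvalues`). Since `h` decreases on `(0, 1]`, the entropy
  of `π'` is at most `h (exp (-S(π)))`.
* Existence. By Williamson's theorem each Gaussian state dominates a pure one
  (`IsGaussian.exists_isPure_le`), so the infimum that defines the squeezing of formation is not
  over the empty set. It is bounded below by zero, hence lies in the closure of the set of values
  `S(π)`, and the bound passes to it by continuity of `h` on `(0, ∞)`.

The same construction also shows that the pure states are exactly the positive definite symplectic
matrices (`IsPure.of_symplectic`, `IsPure.symplectic`).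
-/

namespace GaussianModes

open Matrix

/-! ### Real positive definite matrices -/

section LinearAlgebra

variable {n k : Type*}

theorem isSymm_of_posDef {A : Matrix n n ℝ} (hA : A.PosDef) : Aᵀ = A := by
  simpa using hA.isHermitian.eq

variable [Fintype n] [Fintype k]

theorem quadForm_nonneg {A : Matrix n n ℝ} (hA : A.PosSemidef) (x : n → ℝ) :
    0 ≤ x ⬝ᵥ (A *ᵥ x) := by
  simpa using hA.dotProduct_mulVec_nonneg x

theorem posSemidef_of_quadForm {A : Matrix n n ℝ} (hA : Aᵀ = A)
    (h : ∀ x : n → ℝ, 0 ≤ x ⬝ᵥ (A *ᵥ x)) : A.PosSemidef :=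
  .of_dotProduct_mulVec_nonneg (by simpa [IsHermitian] using hA) (by simpa using h)

theorem quadForm_congr (B : Matrix k n ℝ) (A : Matrix k k ℝ) (x : n → ℝ) :
    x ⬝ᵥ ((Bᵀ * A * B) *ᵥ x) = (B *ᵥ x) ⬝ᵥ (A *ᵥ (B *ᵥ x)) := by
  rw [← mulVec_mulVec, ← mulVec_mulVec, dotProduct_mulVec, vecMul_transpose]

theorem dotProduct_mulVec_self (B : Matrix k n ℝ) (x : n → ℝ) :
    (B *ᵥ x) ⬝ᵥ (B *ᵥ x) = x ⬝ᵥ ((Bᵀ * B) *ᵥ x) := by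
  rw [← mulVec_mulVec, dotProduct_mulVec x, vecMul_transpose]

variable [DecidableEq n] [DecidableEq k]

open scoped MatrixOrder in
/-- The square root of a positive definite matrix is positive definite and lies in the bicommutant
of the matrix. -/
theorem exists_posDef_sqrt {A : Matrix n n ℝ} (hA : A.PosDef) :
    ∃ S : Matrix n n ℝ, S.PosDef ∧ S * S = A ∧ ∀ J, Commute A J → Commute S J := by
  have h0 : 0 ≤ A := Matrix.nonneg_iff_posSemidef.2 hA.posSemidef
  have hS := CFC.sqrt_mul_sqrt_self A h0
  refine ⟨CFC.sqrt A, ?_, hS, fun J hJ => ?_⟩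
  · have hps : (CFC.sqrt A).PosSemidef := Matrix.nonneg_iff_posSemidef.1 (CFC.sqrt_nonneg A)
    rw [hps.posDef_iff_det_ne_zero]
    intro hd
    have := hA.det_pos
    rw [← hS, Matrix.det_mul, hd] at this
    simp at this
  · exact Commute.cfcₙ_nnreal hJ _

theorem exists_inv_sqrt {A : Matrix n n ℝ} (hA : A.PosDef) :
    ∃ T : Matrix n n ℝ, Tᵀ = T ∧ T * T = A⁻¹ ∧ T * A * T = 1 := by
  obtain ⟨S, hS, rfl, -⟩ := exists_posDef_sqrt hA
  have hu : IsUnit S.det := hS.det_pos.ne'.isUnit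
  refine ⟨S⁻¹, ?_, ?_, ?_⟩
  · rw [transpose_nonsing_inv, isSymm_of_posDef hS]
  · rw [Matrix.mul_inv_rev]
  · rw [← mul_assoc, nonsing_inv_mul _ hu, one_mul, mul_nonsing_inv _ hu]

/-- The eigenvalues of `L` lie in `(0, 1]` and have product one. -/
theorem eq_one_of_le_one_of_det_eq_one {L : Matrix n n ℝ} (hL : L.PosDef)
    (hL1 : (1 - L).PosSemidef) (hdet : L.det = 1) : L = 1 := by
  have hH := hL.isHermitian
  have hle : ∀ i, hH.eigenvalues i ≤ 1 := by
    intro i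
    have h1 := quadForm_nonneg hL1 (hH.eigenvectorBasis i)
    have h2 : (hH.eigenvectorBasis i : n → ℝ) ⬝ᵥ (hH.eigenvectorBasis i : n → ℝ) = 1 := by
      have := hH.eigenvectorBasis.orthonormal.1 i
      have h3 : inner ℝ (hH.eigenvectorBasis i) (hH.eigenvectorBasis i) = (1 : ℝ) := by
        rw [real_inner_self_eq_norm_sq, this]; norm_num
      rw [EuclideanSpace.inner_eq_star_dotProduct, star_trivial] at h3
      exact h3
    rw [sub_mulVec, one_mulVec, hH.mulVec_eigenvectorBasis, dotProduct_sub, dotProduct_smul, h2]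
      at h1
    simpa using h1
  have hprod : ∏ i, hH.eigenvalues i = 1 := by
    have := hH.det_eq_prod_eigenvalues
    rw [hdet] at this
    simpa using this.symm
  have hone : ∀ i, hH.eigenvalues i = 1 := by
    intro i
    by_contra hne
    have : ∏ i, hH.eigenvalues i < ∏ _i : n, (1 : ℝ) :=
      Finset.prod_lt_prod (fun i _ => hL.eigenvalues_pos i) (fun i _ => hle i)
        ⟨i, Finset.mem_univ _, lt_of_le_of_ne (hle i) hne⟩
    simp [hprod] at this
  have hsp := hH.spectral_theorem
  have hd : (diagonal (RCLike.ofReal ∘ hH.eigenvalues) : Matrix n n ℝ) = 1 := by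
    rw [← diagonal_one]; congr 1; ext i; simp [hone i]
  rw [hd, map_one] at hsp
  exact hsp

/-- Operator convexity of the inverse under compressions, `(W R⁻¹ Wᵀ)⁻¹ ≤ W R Wᵀ`: with
`Z = (W R⁻¹ Wᵀ)⁻¹` and `D = R Wᵀ - Wᵀ Z`, the difference of the two sides is `Dᵀ R⁻¹ D`. -/
theorem posSemidef_compression_sub_inv {W : Matrix k n ℝ} (hW : W * Wᵀ = 1) {R : Matrix n n ℝ}
    (hR : R.PosDef) : (W * R * Wᵀ - (W * R⁻¹ * Wᵀ)⁻¹).PosSemidef := by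
  have hRu : IsUnit R.det := hR.det_pos.ne'.isUnit
  have hY : (W * R⁻¹ * Wᵀ).PosDef := by
    have := hR.inv.conjTranspose_mul_mul_same (B := Wᵀ) (by
      intro x y hxy
      have := congrArg (W *ᵥ ·) hxy
      simpa [mulVec_mulVec, hW] using this)
    simpa using this
  have hYu : IsUnit (W * R⁻¹ * Wᵀ).det := hY.det_pos.ne'.isUnit
  set Z := (W * R⁻¹ * Wᵀ)⁻¹ with hZ
  have hZs : Zᵀ = Z := isSymm_of_posDef hY.inv
  have hRs : Rᵀ = R := isSymm_of_posDef hR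
  have h := hR.inv.posSemidef.conjTranspose_mul_mul_same (R * Wᵀ - Wᵀ * Z)
  have h1 : Z * (W * R⁻¹ * Wᵀ) = 1 := nonsing_inv_mul _ hYu
  have h2 : R⁻¹ * R = 1 := nonsing_inv_mul _ hRu
  have h3 : R * R⁻¹ = 1 := mul_nonsing_inv _ hRu
  suffices hkey : W * R * Wᵀ - Z = (R * Wᵀ - Wᵀ * Z)ᴴ * R⁻¹ * (R * Wᵀ - Wᵀ * Z) by
    rwa [hkey]
  simp only [conjTranspose_eq_transpose_of_trivial, transpose_sub, transpose_mul,
    transpose_transpose, hZs, hRs]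
  have e : (W * R - Z * W) * R⁻¹ * (R * Wᵀ - Wᵀ * Z)
      = W * (R * R⁻¹) * R * Wᵀ - W * (R * R⁻¹) * Wᵀ * Z - Z * (W * (R⁻¹ * R) * Wᵀ)
        + Z * (W * R⁻¹ * Wᵀ) * Z := by
    simp only [Matrix.sub_mul, Matrix.mul_sub, Matrix.mul_assoc]
    abel
  rw [e, h1, h2, h3, Matrix.mul_one, hW, Matrix.one_mul, Matrix.mul_one]
  abel

end LinearAlgebra

/-! ### Complex vectors through their real and imaginary parts -/

section ComplexVectors

variable {n : Type*} [Fintype n]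

theorem map_ofReal_mulVec (M : Matrix n n ℝ) (u v : n → ℝ) :
    M.map Complex.ofReal *ᵥ (fun i => (⟨u i, v i⟩ : ℂ)) =
      fun i => (⟨(M *ᵥ u) i, (M *ᵥ v) i⟩ : ℂ) := by
  ext i
  apply Complex.ext <;> simp [mulVec, dotProduct]

theorem star_dotProduct_mk (u v u' v' : n → ℝ) :
    star (fun i => (⟨u i, v i⟩ : ℂ)) ⬝ᵥ (fun i => (⟨u' i, v' i⟩ : ℂ)) =
      ⟨u ⬝ᵥ u' + v ⬝ᵥ v', u ⬝ᵥ v' - v ⬝ᵥ u'⟩ := by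
  apply Complex.ext <;>
    simp [dotProduct, Finset.sum_add_distrib, Finset.sum_sub_distrib, ← sub_eq_add_neg]

end ComplexVectors

/-! ### Covariance matrices and the symplectic form -/

section Symplectic

variable {m : Type*} [DecidableEq m]

theorem symplecticForm_transpose : (symplecticForm m)ᵀ = -symplecticForm m := by
  ext ⟨i, a⟩ ⟨j, b⟩
  fin_cases a <;> fin_cases b <;> simp [symplecticForm, kroneckerMap_apply, one_apply, eq_comm]

variable [Fintype m]

theorem symplecticForm_mul_self : symplecticForm m * symplecticForm m = -1 := by
  have h : (!![0, 1; -1, 0] * !![0, 1; -1, 0] : Matrix (Fin 2) (Fin 2) ℝ) = -1 := by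
    ext i j; fin_cases i <;> fin_cases j <;> simp
  rw [symplecticForm, ← mul_kronecker_mul, h, one_mul,
    ← neg_one_smul ℝ (1 : Matrix (Fin 2) (Fin 2) ℝ), kronecker_smul, one_kronecker_one,
    neg_one_smul]

theorem det_symplecticForm_ne_zero : (symplecticForm m).det ≠ 0 := by
  intro h
  have h1 := congrArg det (symplecticForm_mul_self (m := m))
  rw [det_mul, h, det_neg, det_one] at h1
  simp at h1

theorem symplecticForm_mulVec_dotProduct (u v : PhaseIdx m → ℝ) :
    (symplecticForm m *ᵥ u) ⬝ᵥ v = -(u ⬝ᵥ (symplecticForm m *ᵥ v)) := by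
  rw [dotProduct_mulVec u, ← mulVec_transpose, symplecticForm_transpose, neg_mulVec,
    neg_dotProduct, neg_neg]

/-- The uncertainty relation `σ + iΩ ≥ 0`, evaluated at the complex vector `u + iv`. -/
theorem uncertainty_iff {σ : Matrix (PhaseIdx m) (PhaseIdx m) ℝ} (hσ : σᵀ = σ) :
    (σ.map Complex.ofReal + Complex.I • (symplecticForm m).map Complex.ofReal).PosSemidef ↔
      ∀ u v : PhaseIdx m → ℝ,
        2 * (u ⬝ᵥ (symplecticForm m *ᵥ v)) ≤ u ⬝ᵥ (σ *ᵥ u) + v ⬝ᵥ (σ *ᵥ v) := by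
  have key : ∀ u v : PhaseIdx m → ℝ,
      star (fun i => (⟨u i, v i⟩ : ℂ)) ⬝ᵥ
        ((σ.map Complex.ofReal + Complex.I • (symplecticForm m).map Complex.ofReal) *ᵥ
          (fun i => (⟨u i, v i⟩ : ℂ))) =
      ((u ⬝ᵥ (σ *ᵥ u) + v ⬝ᵥ (σ *ᵥ v) - 2 * (u ⬝ᵥ (symplecticForm m *ᵥ v)) : ℝ) : ℂ) := by
    intro u v
    have h1 : u ⬝ᵥ (σ *ᵥ v) = v ⬝ᵥ (σ *ᵥ u) := by
      rw [dotProduct_mulVec, ← mulVec_transpose, hσ, dotProduct_comm]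
    have h2 : ∀ w z : PhaseIdx m → ℝ, w ⬝ᵥ (symplecticForm m *ᵥ z) =
        -(z ⬝ᵥ (symplecticForm m *ᵥ w)) := fun w z => by
      rw [← symplecticForm_mulVec_dotProduct, dotProduct_comm]
    have h3 : u ⬝ᵥ (symplecticForm m *ᵥ u) = 0 := by linarith [h2 u u]
    have h4 : v ⬝ᵥ (symplecticForm m *ᵥ v) = 0 := by linarith [h2 v v]
    rw [add_mulVec, smul_mulVec, dotProduct_add, dotProduct_smul, map_ofReal_mulVec,
      map_ofReal_mulVec, star_dotProduct_mk, star_dotProduct_mk, h1, h2 v u, h3, h4]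
    apply Complex.ext <;> simp
    ring
  rw [posSemidef_iff_dotProduct_mulVec]
  constructor
  · rintro ⟨-, h⟩ u v
    have := h fun i => (⟨u i, v i⟩ : ℂ)
    rw [key, Complex.zero_le_real] at this
    linarith
  · intro h
    refine ⟨?_, fun x => ?_⟩
    · ext i j
      have e1 := congrFun (congrFun hσ i) j
      have e2 := congrFun (congrFun (symplecticForm_transpose (m := m)) i) j
      simp only [transpose_apply] at e1 e2
      simp [conjTranspose_apply, e1, e2]
    · have := key (fun i => (x i).re) (fun i => (x i).im)
      simp only [Complex.eta] at this
      rw [this, Complex.zero_le_real]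
      linarith [h (fun i => (x i).re) (fun i => (x i).im)]

/-- A positive definite symplectic matrix is the covariance matrix of a pure state. -/
theorem IsPure.of_symplectic {π : Matrix (PhaseIdx m) (PhaseIdx m) ℝ} (hπ : π.PosDef)
    (h : π * symplecticForm m * π = symplecticForm m) : IsPure π where
  posDef := hπ
  uncertainty := by
    rw [uncertainty_iff (isSymm_of_posDef hπ)]
    intro u v
    have hs := isSymm_of_posDef hπ
    -- As `π Ω π = Ω`, the vector `Ω π v` has the same form as `v`, and pairs with `u` to `u ⬝ Ω v`.
    have h0 := quadForm_nonneg hπ.posSemidef (u - (symplecticForm m * π) *ᵥ v)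
    have e1 : (symplecticForm m * π) *ᵥ v ⬝ᵥ (π *ᵥ ((symplecticForm m * π) *ᵥ v))
        = v ⬝ᵥ (π *ᵥ v) := by
      rw [← quadForm_congr, transpose_mul, hs, symplecticForm_transpose]
      congr 2
      calc π * -symplecticForm m * π * (symplecticForm m * π)
          = -(π * symplecticForm m * (π * symplecticForm m * π)) := by noncomm_ring
        _ = π := by rw [h, mul_assoc, symplecticForm_mul_self]; simp
    have e2 : u ⬝ᵥ (π *ᵥ ((symplecticForm m * π) *ᵥ v)) = u ⬝ᵥ (symplecticForm m *ᵥ v) := by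
      rw [mulVec_mulVec, ← mul_assoc, h]
    have e3 : (symplecticForm m * π) *ᵥ v ⬝ᵥ (π *ᵥ u) = u ⬝ᵥ (symplecticForm m *ᵥ v) := by
      rw [← e2, dotProduct_mulVec, ← mulVec_transpose, hs, dotProduct_comm]
    rw [mulVec_sub, sub_dotProduct, dotProduct_sub, dotProduct_sub, e1, e2, e3] at h0
    linarith
  det_eq_one := by
    have h1 := congrArg det h
    rw [det_mul, det_mul, mul_right_comm] at h1
    have h2 : π.det * π.det = 1 :=
      mul_right_cancel₀ det_symplecticForm_ne_zero (by rw [h1, one_mul])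
    nlinarith [hπ.det_pos]

/-- Williamson's theorem in the form needed here: below `σ = S²` there is a positive definite
symplectic matrix `S L S`, with `L ≤ 1`. The antisymmetric matrix `J = S⁻¹ Ω S⁻¹` is a contraction
by the uncertainty relation, and `L` is its absolute value `√(Jᵀ J)`. -/
theorem IsGaussian.exists_symplectic_factor {σ : Matrix (PhaseIdx m) (PhaseIdx m) ℝ}
    (hσ : IsGaussian σ) :
    ∃ S L : Matrix (PhaseIdx m) (PhaseIdx m) ℝ, S.PosDef ∧ S * S = σ ∧ L.PosDef ∧
      (1 - L).PosSemidef ∧ S * L * S * symplecticForm m * (S * L * S) = symplecticForm m := by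
  obtain ⟨S, hS, rfl, -⟩ := exists_posDef_sqrt hσ.posDef
  have hSu : IsUnit S.det := hS.det_pos.ne'.isUnit
  have hSs := isSymm_of_posDef hS
  have hCs := isSymm_of_posDef hS.inv
  have hSC : S * S⁻¹ = 1 := mul_nonsing_inv _ hSu
  have hCS : S⁻¹ * S = 1 := nonsing_inv_mul _ hSu
  set Ω := symplecticForm m with hΩ
  have hΩΩ : Ω * Ω = -1 := symplecticForm_mul_self
  set J := S⁻¹ * Ω * S⁻¹ with hJ
  have hJt : Jᵀ = -J := by
    rw [hJ, transpose_mul, transpose_mul, hCs, symplecticForm_transpose]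
    noncomm_ring
  have hJinv : J * (S * Ω * S) = -1 := by
    calc J * (S * Ω * S) = S⁻¹ * Ω * (S⁻¹ * S) * Ω * S := by rw [hJ]; noncomm_ring
      _ = S⁻¹ * (Ω * Ω) * S := by rw [hCS]; noncomm_ring
      _ = -1 := by rw [hΩΩ]; simp [hCS]
  have hJdet : J.det ≠ 0 := by
    intro h0
    have := congrArg det hJinv
    rw [det_mul, h0, det_neg, det_one] at this
    simp at this
  -- `‖J v‖ ≤ ‖v‖` is the uncertainty relation at `S⁻¹ J v` and `S⁻¹ v`.
  have hcontr : ∀ v, (J *ᵥ v) ⬝ᵥ (J *ᵥ v) ≤ v ⬝ᵥ v := by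
    have hu := (uncertainty_iff (isSymm_of_posDef hσ.posDef)).1 hσ.uncertainty
    have hnorm : ∀ w, (S⁻¹ *ᵥ w) ⬝ᵥ ((S * S) *ᵥ (S⁻¹ *ᵥ w)) = w ⬝ᵥ w := by
      intro w
      rw [← quadForm_congr, hCs, ← mul_assoc, hCS, one_mul, hSC, one_mulVec]
    intro v
    have h := hu (S⁻¹ *ᵥ (J *ᵥ v)) (S⁻¹ *ᵥ v)
    rw [hnorm, hnorm] at h
    have e : (S⁻¹ *ᵥ (J *ᵥ v)) ⬝ᵥ (Ω *ᵥ (S⁻¹ *ᵥ v)) = (J *ᵥ v) ⬝ᵥ (J *ᵥ v) := by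
      conv_rhs => rw [hJ, ← mulVec_mulVec v, ← mulVec_mulVec, dotProduct_mulVec _ S⁻¹,
        ← mulVec_transpose, hCs]
      simp only [mulVec_mulVec, hJ, mul_assoc]
    rw [e] at h
    linarith
  have hJJ : (Jᵀ * J).PosDef := by
    have hps : (Jᵀ * J).PosSemidef := by simpa using posSemidef_conjTranspose_mul_self J
    rw [hps.posDef_iff_det_ne_zero, det_mul, det_transpose]
    exact mul_ne_zero hJdet hJdet
  obtain ⟨L, hL, hLL, hcomm⟩ := exists_posDef_sqrt hJJ
  have hLs := isSymm_of_posDef hL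
  have hLJ : L * J = J * L := by
    refine hcomm J ?_
    rw [hJt]
    show -J * J * J = J * (-J * J)
    noncomm_ring
  refine ⟨S, L, hS, rfl, hL, posSemidef_of_quadForm (by simp [hLs]) fun x => ?_, ?_⟩
  · have h1 : (L *ᵥ x) ⬝ᵥ (L *ᵥ x) ≤ x ⬝ᵥ x := by
      rw [dotProduct_mulVec_self, hLs, hLL, ← dotProduct_mulVec_self]
      exact hcontr x
    have h2 : 0 ≤ (x - L *ᵥ x) ⬝ᵥ (x - L *ᵥ x) := by
      simpa using dotProduct_star_self_nonneg (x - L *ᵥ x)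
    rw [sub_dotProduct, dotProduct_sub, dotProduct_sub, dotProduct_comm (L *ᵥ x) x] at h2
    rw [sub_mulVec, one_mulVec, dotProduct_sub]
    linarith
  · -- `SΩS = -J⁻¹` commutes with `L`, and `L² = -J²`.
    have hJinv' : (S * Ω * S) * J = -1 := by
      have h1 : J * (-(S * Ω * S)) = 1 := by rw [mul_neg, hJinv, neg_neg]
      have h2 := mul_eq_one_comm.1 h1
      rw [neg_mul] at h2
      rw [← h2, neg_neg]
    have hcomm2 : L * (S * Ω * S) = (S * Ω * S) * L := by
      calc L * (S * Ω * S) = -(((S * Ω * S) * J) * L * (S * Ω * S)) := by rw [hJinv']; simp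
        _ = -((S * Ω * S) * (J * L) * (S * Ω * S)) := by noncomm_ring
        _ = -((S * Ω * S) * L * (J * (S * Ω * S))) := by rw [← hLJ]; noncomm_ring
        _ = (S * Ω * S) * L := by rw [hJinv]; simp
    calc S * L * S * Ω * (S * L * S) = S * (L * (S * Ω * S)) * L * S := by noncomm_ring
      _ = S * (S * Ω * S) * (L * L) * S := by rw [hcomm2]; noncomm_ring
      _ = -(S * ((S * Ω * S) * J) * J * S) := by rw [hLL, hJt]; noncomm_ring
      _ = S * J * S := by rw [hJinv']; noncomm_ring
      _ = (S * S⁻¹) * Ω * (S⁻¹ * S) := by rw [hJ]; noncomm_ring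
      _ = Ω := by rw [hSC, hCS, one_mul, mul_one]

theorem IsGaussian.exists_isPure_le {σ : Matrix (PhaseIdx m) (PhaseIdx m) ℝ}
    (hσ : IsGaussian σ) : ∃ π, IsPure π ∧ (σ - π).PosSemidef := by
  obtain ⟨S, L, hS, rfl, hL, hL1, h⟩ := hσ.exists_symplectic_factor
  have hSs := isSymm_of_posDef hS
  refine ⟨S * L * S, .of_symplectic ?_ h, ?_⟩
  · have hps : (S * L * S).PosSemidef := by
      have := hL.posSemidef.conjTranspose_mul_mul_same S
      rwa [conjTranspose_eq_transpose_of_trivial, hSs] at this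
    rw [hps.posDef_iff_det_ne_zero, det_mul, det_mul]
    exact (mul_pos (mul_pos hS.det_pos hL.det_pos) hS.det_pos).ne'
  · have := hL1.conjTranspose_mul_mul_same S
    rw [conjTranspose_eq_transpose_of_trivial, hSs] at this
    convert this using 1
    noncomm_ring

/-- Conversely, the covariance matrix of a pure state is symplectic: since `det σ = 1`, the factor
`L ≤ 1` of Williamson's theorem has determinant one, so it is the identity. -/
theorem IsPure.symplectic {π : Matrix (PhaseIdx m) (PhaseIdx m) ℝ} (hπ : IsPure π) :
    π * symplecticForm m * π = symplecticForm m := by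
  obtain ⟨S, L, hS, rfl, hL, hL1, h⟩ := hπ.toIsGaussian.exists_symplectic_factor
  have hSd : S.det * S.det = 1 := by rw [← det_mul, hπ.det_eq_one]
  have h1 := congrArg det h
  simp only [det_mul] at h1
  have h2 : L.det * L.det = 1 := by
    refine mul_right_cancel₀ (det_symplecticForm_ne_zero (m := m)) ?_
    calc L.det * L.det * (symplecticForm m).det
        = (S.det * S.det) * (S.det * S.det) * (L.det * L.det * (symplecticForm m).det) := by
          rw [hSd]; ring
      _ = 1 * (symplecticForm m).det := by linear_combination h1
  have hL' : L = 1 := eq_one_of_le_one_of_det_eq_one hL hL1 (by nlinarith [hL.det_pos])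
  simpa [hL'] using h

end Symplectic

/-! ### The two lowest eigenvalues as bounds on the quadratic form -/

section LowestEigenvalues

variable {n : Type*} [Fintype n]

/-- The quadratic form of `A` is at least `b‖x‖²` on the orthogonal complement of `e` (which is the
whole space if `e = 0`). -/
def FormBound (A : Matrix n n ℝ) (b : ℝ) (e : n → ℝ) : Prop :=
  ∀ x : n → ℝ, x ⬝ᵥ e = 0 → b * (x ⬝ᵥ x) ≤ x ⬝ᵥ (A *ᵥ x)

/-- Lower bounds `a` and `b` on the two lowest eigenvalues of `A`, in the form of the min-max
principle: the quadratic form of `A` is bounded below by `a` everywhere and by `b` on the orthogonal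
complement of some vector. Unlike the eigenvalues, this passes through compressions at once. -/
structure HasLowBounds (A : Matrix n n ℝ) (a b : ℝ) : Prop where
  lowest : FormBound A a 0
  secondLowest : ∃ e, FormBound A b e

/-- Lower bounds on `A` turn into upper bounds on `A⁻¹` under the substitution `x ↦ T x`, where `T`
is the inverse square root of `A`. -/
theorem FormBound.inv_apply {A T : Matrix n n ℝ} (hT : Tᵀ = T) [DecidableEq n]
    (hTT : T * T = A⁻¹) (hTA : T * A * T = 1) {b : ℝ} {e : n → ℝ} (h : FormBound A b e)
    {x : n → ℝ} (hx : x ⬝ᵥ (T *ᵥ e) = 0) : b * (x ⬝ᵥ (A⁻¹ *ᵥ x)) ≤ x ⬝ᵥ x := by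
  have h1 := h (T *ᵥ x) (by rw [← hx, dotProduct_mulVec, ← mulVec_transpose, hT])
  rwa [dotProduct_mulVec_self, hT, hTT, ← quadForm_congr, hT, hTA, one_mulVec] at h1

/-- If all eigenvalues outside `s` are at least `b`, then the quadratic form is bounded below by `b`
on the vectors orthogonal to the eigenvectors that `s` labels. -/
theorem formBound_of_eigenvalues [DecidableEq n] {A : Matrix n n ℝ} (hA : A.IsHermitian) {b : ℝ}
    {s : Set n} (hb : ∀ i ∉ s, b ≤ hA.eigenvalues i) {e : n → ℝ}
    (he : ∀ x, x ⬝ᵥ e = 0 → ∀ i ∈ s, (hA.eigenvectorBasis i : n → ℝ) ⬝ᵥ x = 0) :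
    FormBound A b e := by
  intro x hx
  set U : Matrix n n ℝ := (hA.eigenvectorUnitary : Matrix n n ℝ) with hU
  have hUU : U * Uᵀ = 1 := by
    have := Unitary.coe_mul_star_self hA.eigenvectorUnitary
    simpa [star_eq_conjTranspose, conjTranspose_eq_transpose_of_trivial] using this
  have hsp : A = U * diagonal hA.eigenvalues * Uᵀ := by
    have := hA.spectral_theorem
    rw [Unitary.conjStarAlgAut_apply] at this
    simpa [star_eq_conjTranspose, conjTranspose_eq_transpose_of_trivial, Function.comp_def]
      using this
  have hxx : x ⬝ᵥ x = (Uᵀ *ᵥ x) ⬝ᵥ (Uᵀ *ᵥ x) := by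
    rw [dotProduct_mulVec_self, transpose_transpose, hUU, one_mulVec]
  have hxA : x ⬝ᵥ (A *ᵥ x) = (Uᵀ *ᵥ x) ⬝ᵥ (diagonal hA.eigenvalues *ᵥ (Uᵀ *ᵥ x)) := by
    rw [← quadForm_congr, transpose_transpose, ← hsp]
  have hco : ∀ i, (Uᵀ *ᵥ x) i = (hA.eigenvectorBasis i : n → ℝ) ⬝ᵥ x := by
    intro i
    rw [mulVec, ← hA.eigenvectorUnitary_transpose_apply]
  rw [hxx, hxA, dotProduct, dotProduct, Finset.mul_sum]
  refine Finset.sum_le_sum fun i _ => ?_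
  rw [mulVec_diagonal]
  by_cases hi : i ∈ s
  · rw [hco, he x hx i hi]; simp
  · nlinarith [mul_nonneg (sub_nonneg.2 (hb i hi)) (mul_self_nonneg ((Uᵀ *ᵥ x) i))]

end LowestEigenvalues

/-! ### Squeezing of pure two-mode states -/

section TwoModes

theorem exists_ne_zero_dotProduct_eq_zero {n : Type*} [Fintype n] (hn : 2 < Fintype.card n)
    (f g : n → ℝ) : ∃ x : n → ℝ, x ≠ 0 ∧ x ⬝ᵥ f = 0 ∧ x ⬝ᵥ g = 0 := by
  have h : LinearMap.ker (Matrix.mulVecLin (Matrix.of ![f, g])) ≠ ⊥ :=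
    LinearMap.ker_ne_bot_of_finrank_lt (by simpa using hn)
  obtain ⟨x, hx, hx0⟩ := (Submodule.ne_bot_iff _).1 h
  rw [LinearMap.mem_ker, mulVecLin_apply] at hx
  refine ⟨x, hx0, ?_, ?_⟩
  · rw [dotProduct_comm]; exact congrFun hx 0
  · rw [dotProduct_comm]; exact congrFun hx 1

variable {π : Matrix (PhaseIdx (Fin 2)) (PhaseIdx (Fin 2)) ℝ}

/-- The second lowest eigenvalue of a pure two-mode state is at most one. The form of `π` is at
least `b` on a hyperplane; the form of `π⁻¹ = Ωᵀ π Ω` is then at least `b` on one hyperplane and at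
most `b⁻¹` on another, and two hyperplanes of a four-dimensional space share a nonzero vector. -/
theorem IsPure.le_one_of_formBound (hπ : IsPure π) {b : ℝ} (hb : 0 ≤ b)
    {e : PhaseIdx (Fin 2) → ℝ} (h : FormBound π b e) : b ≤ 1 := by
  obtain ⟨T, hT, hTT, hTA⟩ := exists_inv_sqrt hπ.posDef
  set Ω := symplecticForm (Fin 2) with hΩ
  have hinv : π⁻¹ = Ωᵀ * π * Ω := by
    refine inv_eq_left_inv ?_
    have h1 : Ω * Ω = -1 := symplecticForm_mul_self
    calc Ωᵀ * π * Ω * π = -(Ω * (π * Ω * π)) := by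
          rw [hΩ, symplecticForm_transpose]; noncomm_ring
      _ = 1 := by rw [hπ.symplectic, ← hΩ, h1, neg_neg]
  obtain ⟨x, hx0, hx1, hx2⟩ := exists_ne_zero_dotProduct_eq_zero (by simp) (T *ᵥ e) (Ω *ᵥ e)
  have h1 := h.inv_apply hT hTT hTA hx1
  have h2 := h (Ω *ᵥ x) (by rw [symplecticForm_mulVec_dotProduct, hx2, neg_zero])
  rw [← quadForm_congr, ← hinv, dotProduct_mulVec_self, hΩ, symplecticForm_transpose, neg_mul,
    symplecticForm_mul_self, neg_neg, one_mulVec] at h2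
  have hxx : 0 < x ⬝ᵥ x := by
    simpa using dotProduct_star_self_pos_iff.2 hx0
  by_contra! hb1
  nlinarith [mul_le_mul_of_nonneg_left h2 hb, mul_pos (sub_pos.2 hb1) hxx]

theorem pureSqueezing_eq (hπ : IsPure π) :
    pureSqueezing π hπ = -(1 / 2) *
      (Real.log (increasingEigenvalues hπ.posDef.isHermitian ⟨0, by simp⟩) +
        Real.log (increasingEigenvalues hπ.posDef.isHermitian ⟨1, by simp⟩)) := by
  have key : ∀ (N M : ℕ) (hN : N = 4) (_ : M = 2) (f : Fin N → ℝ),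
      ∑ i : Fin N with i.val < M, f i = f ⟨0, by lia⟩ + f ⟨1, by lia⟩ := by
    rintro _ _ rfl rfl f
    simp [Finset.sum_filter, Fin.sum_univ_four]
  rw [pureSqueezing, key _ _ (by simp) (by simp)]

theorem IsPure.exists_hasLowBounds (hπ : IsPure π) :
    ∃ a b : ℝ, 0 < a ∧ a ≤ b ∧ b ≤ 1 ∧ HasLowBounds π a b ∧
      Real.exp (-pureSqueezing π hπ) = √(a * b) := by
  have hH := hπ.posDef.isHermitian
  set q := (Fintype.equivOfCardEq (Fintype.card_fin _) :
    Fin (Fintype.card (PhaseIdx (Fin 2))) ≃ PhaseIdx (Fin 2)) with hq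
  have hev : ∀ i, increasingEigenvalues hH i = hH.eigenvalues (q i.rev) := by
    intro i
    simp [increasingEigenvalues, IsHermitian.eigenvalues, hq]
  have hmono : Monotone (increasingEigenvalues hH) := fun i j hij =>
    hH.eigenvalues₀_antitone (Fin.rev_le_rev.2 hij)
  have hpos : ∀ i, 0 < increasingEigenvalues hH i := fun i => by
    rw [hev]; exact hπ.posDef.eigenvalues_pos _
  set i0 : Fin (Fintype.card (PhaseIdx (Fin 2))) := ⟨0, by simp⟩ with hi0
  set i1 : Fin (Fintype.card (PhaseIdx (Fin 2))) := ⟨1, by simp⟩ with hi1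
  have hev' : ∀ j, hH.eigenvalues j = increasingEigenvalues hH (q.symm j).rev := by
    intro j; simp [hev]
  have hB1 : FormBound π (increasingEigenvalues hH i0) 0 := by
    refine formBound_of_eigenvalues hH (s := ∅) (fun i _ => ?_) (by simp)
    rw [hev']
    exact hmono (Fin.le_def.2 (Nat.zero_le _))
  have hB2 : FormBound π (increasingEigenvalues hH i1) (hH.eigenvectorBasis (q i0.rev)) := by
    refine formBound_of_eigenvalues hH (s := {q i0.rev}) (fun i hi => ?_) ?_
    · rw [hev']
      refine hmono (Fin.le_def.2 (Nat.one_le_iff_ne_zero.2 fun h0 => hi ?_))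
      have : (q.symm i).rev = i0 := Fin.ext h0
      rw [← this]
      simp
    · rintro x hx _ rfl
      rwa [dotProduct_comm]
  refine ⟨_, _, hpos i0, hmono (Fin.le_def.2 (Nat.zero_le _)),
    hπ.le_one_of_formBound (hpos i1).le hB2, ⟨hB1, _, hB2⟩, ?_⟩
  rw [pureSqueezing_eq, ← Real.log_mul (hpos i0).ne' (hpos i1).ne', Real.sqrt_eq_rpow,
    Real.rpow_def_of_pos (mul_pos (hpos i0) (hpos i1))]
  congr 1
  ring

end TwoModes

/-! ### Compression of pure states in the Cayley picture -/

section Cayley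

variable {m m' : Type*} [Fintype m] [DecidableEq m] [Fintype m'] [DecidableEq m']

/-- Let `W` be a coisometry that intertwines the symplectic forms, and `Q` a positive definite
symplectic matrix. Below the compression `W Q Wᵀ` there is a pure state with the same lower bounds
on its two lowest eigenvalues. It is the one whose Cayley transform is the compression of that of
`Q`: in terms of `Y = (Q + 1)⁻¹`, symplecticity of `Q` is the linear condition `Y Ω + Ω Y = Ω`,
which compressions preserve, and the claims about order follow from operator convexity of the
inverse and from the bounds on quadratic forms. -/
theorem exists_isPure_le_compression {W : Matrix (PhaseIdx m') (PhaseIdx m) ℝ} (hW : W * Wᵀ = 1)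
    (hWΩ : W * symplecticForm m = symplecticForm m' * W)
    {Q : Matrix (PhaseIdx m) (PhaseIdx m) ℝ} (hQ : Q.PosDef)
    (hQΩ : Q * symplecticForm m * Q = symplecticForm m) {a b : ℝ} (hab : HasLowBounds Q a b) :
    ∃ π, IsPure π ∧ (W * Q * Wᵀ - π).PosSemidef ∧ HasLowBounds π a b := by
  have hWΩ' : symplecticForm m * Wᵀ = Wᵀ * symplecticForm m' := by
    have := congrArg transpose hWΩ
    simpa [symplecticForm_transpose] using this
  have hR : (Q + 1).PosDef := hQ.add PosDef.one
  have hRu : IsUnit (Q + 1).det := hR.det_pos.ne'.isUnit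
  set R := Q + 1 with hRdef
  have hinj : Function.Injective Wᵀ.mulVec := by
    intro x y hxy
    have := congrArg (W *ᵥ ·) hxy
    simpa [mulVec_mulVec, hW] using this
  have hY : (W * R⁻¹ * Wᵀ).PosDef := by
    simpa using hR.inv.conjTranspose_mul_mul_same (B := Wᵀ) hinj
  have hYu : IsUnit (W * R⁻¹ * Wᵀ).det := hY.det_pos.ne'.isUnit
  have hle := posSemidef_compression_sub_inv hW hR
  have hRinv : R⁻¹ * symplecticForm m + symplecticForm m * R⁻¹ = symplecticForm m := by
    have h1 : R * symplecticForm m * R = R * symplecticForm m + symplecticForm m * R := by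
      calc R * symplecticForm m * R = Q * symplecticForm m * Q + Q * symplecticForm m
            + symplecticForm m * Q + symplecticForm m := by rw [hRdef]; noncomm_ring
        _ = R * symplecticForm m + symplecticForm m * R := by rw [hQΩ, hRdef]; noncomm_ring
    have h2 : R⁻¹ * R = 1 := nonsing_inv_mul _ hRu
    have h3 : R * R⁻¹ = 1 := mul_nonsing_inv _ hRu
    calc R⁻¹ * symplecticForm m + symplecticForm m * R⁻¹
        = R⁻¹ * symplecticForm m * (R * R⁻¹) + (R⁻¹ * R) * symplecticForm m * R⁻¹ := by
          rw [h2, h3, mul_one, one_mul]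
      _ = R⁻¹ * (R * symplecticForm m + symplecticForm m * R) * R⁻¹ := by noncomm_ring
      _ = (R⁻¹ * R) * symplecticForm m * (R * R⁻¹) := by rw [← h1]; noncomm_ring
      _ = symplecticForm m := by rw [h2, h3, mul_one, one_mul]
  obtain ⟨T, hT, hTT, hTR⟩ := exists_inv_sqrt hR
  obtain ⟨T', hT', hTT', hTY⟩ := exists_inv_sqrt hY
  set Y := W * R⁻¹ * Wᵀ with hYdef
  have hYΩ : Y * symplecticForm m' + symplecticForm m' * Y = symplecticForm m' := by
    calc Y * symplecticForm m' + symplecticForm m' * Y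
        = W * (R⁻¹ * symplecticForm m + symplecticForm m * R⁻¹) * Wᵀ := by
          simp only [hYdef, Matrix.mul_assoc, ← hWΩ', Matrix.mul_add, Matrix.add_mul]
          rw [← Matrix.mul_assoc _ W, ← hWΩ, Matrix.mul_assoc]
      _ = symplecticForm m' := by
          rw [hRinv, hWΩ, Matrix.mul_assoc, hW, Matrix.mul_one]
  have hYY : Y⁻¹ * Y = 1 := nonsing_inv_mul _ hYu
  have hYY' : Y * Y⁻¹ = 1 := mul_nonsing_inv _ hYu
  have hYs := isSymm_of_posDef hY
  -- `1 - Y` is congruent to `Y`, hence positive definite, which makes `Y⁻¹ - 1` so too.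
  have h1Y : 1 - Y = (symplecticForm m')ᵀ * Y * symplecticForm m' := by
    rw [symplecticForm_transpose]
    calc 1 - Y = -(symplecticForm m' * symplecticForm m') - Y := by
          rw [symplecticForm_mul_self, neg_neg]
      _ = -(symplecticForm m' * (Y * symplecticForm m' + symplecticForm m' * Y)) - Y := by rw [hYΩ]
      _ = -symplecticForm m' * Y * symplecticForm m'
          - (symplecticForm m' * symplecticForm m') * Y - Y := by noncomm_ring
      _ = -symplecticForm m' * Y * symplecticForm m' := by
          rw [symplecticForm_mul_self]; noncomm_ring
  have h1Ypos : (1 - Y).PosDef := by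
    rw [h1Y]
    have := hY.conjTranspose_mul_mul_same (B := symplecticForm m') (by
      rw [mulVec_injective_iff_isUnit, isUnit_iff_isUnit_det]
      exact det_symplecticForm_ne_zero.isUnit)
    simpa using this
  -- A bound on `Q` is carried to `(Q + 1)⁻¹`, compressed to `Y`, and carried back to `Y⁻¹ - 1`.
  have hbound : ∀ {r : ℝ} {e}, FormBound Q r e →
      FormBound (Y⁻¹ - 1) r (T' *ᵥ (W *ᵥ (T *ᵥ e))) := by
    intro r e h z hz
    have hR' : FormBound R (1 + r) e := by
      intro x hx
      rw [hRdef, add_mulVec, one_mulVec, dotProduct_add]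
      linarith [h x hx]
    have h1 := hR'.inv_apply hT hTT hTR (x := Wᵀ *ᵥ (T' *ᵥ z)) (by
      rw [← hz, ← vecMul_transpose, ← dotProduct_mulVec, dotProduct_mulVec z,
        ← mulVec_transpose, hT', transpose_transpose])
    rw [← quadForm_congr, dotProduct_mulVec_self, transpose_transpose, hW, one_mulVec, ← hYdef,
      ← quadForm_congr, hT', hTY, one_mulVec, dotProduct_mulVec_self, hT', hTT'] at h1
    rw [sub_mulVec, one_mulVec, dotProduct_sub]
    linarith
  refine ⟨Y⁻¹ - 1, .of_symplectic ?_ ?_, ?_, ?_, ?_⟩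
  · have hsplit : Y⁻¹ - 1 = (1 - Y)ᴴ * Y⁻¹ * (1 - Y) + (1 - Y) := by
      rw [h1Ypos.isHermitian.eq]
      calc Y⁻¹ - 1 = Y⁻¹ - 1 - (Y * Y⁻¹) + Y * (Y⁻¹ * Y) + 1 - Y := by
            rw [hYY', hYY]; noncomm_ring
        _ = Y⁻¹ - (Y⁻¹ * Y) - (Y * Y⁻¹) + Y * (Y⁻¹ * Y) + 1 - Y := by rw [hYY]
        _ = _ := by noncomm_ring
    rw [hsplit]
    exact PosDef.posSemidef_add (hY.inv.posSemidef.conjTranspose_mul_mul_same _) h1Ypos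
  · calc (Y⁻¹ - 1) * symplecticForm m' * (Y⁻¹ - 1)
        = Y⁻¹ * symplecticForm m' * Y⁻¹ - (Y⁻¹ * symplecticForm m' * (Y * Y⁻¹)
          + (Y⁻¹ * Y) * symplecticForm m' * Y⁻¹) + symplecticForm m' := by
          rw [hYY, hYY']; noncomm_ring
      _ = Y⁻¹ * symplecticForm m' * Y⁻¹
          - Y⁻¹ * (Y * symplecticForm m' + symplecticForm m' * Y) * Y⁻¹ + symplecticForm m' := by
          noncomm_ring
      _ = symplecticForm m' := by rw [hYΩ]; noncomm_ring
  · have e : W * Q * Wᵀ - (Y⁻¹ - 1) = W * R * Wᵀ - Y⁻¹ := by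
      rw [hRdef, Matrix.mul_add, Matrix.add_mul, Matrix.mul_one, hW]
      abel
    rw [e]
    exact hle
  · simpa using hbound hab.lowest
  · obtain ⟨e, he⟩ := hab.secondLowest
    exact ⟨_, hbound he⟩

end Cayley

/-! ### The partial transpose -/

section PartialTranspose

/-- The matrix `diag(1, 1, 1, -1)`, by which partial transposition conjugates. -/
def momentumFlip : Matrix (PhaseIdx (Fin 2)) (PhaseIdx (Fin 2)) ℝ :=
  diagonal fun k => if k = (1, 1) then -1 else 1

theorem momentumFlip_transpose : momentumFlipᵀ = momentumFlip := diagonal_transpose _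

theorem momentumFlip_mul_self : momentumFlip * momentumFlip = 1 := by
  rw [momentumFlip, diagonal_mul_diagonal, ← diagonal_one]
  congr 1
  ext k
  split_ifs <;> simp

theorem dotProduct_sq_le {n : Type*} [Fintype n] (x y : n → ℝ) :
    (x ⬝ᵥ y) ^ 2 ≤ (x ⬝ᵥ x) * (y ⬝ᵥ y) := by
  simpa [dotProduct, sq] using Finset.sum_mul_sq_le_sq_mul_sq Finset.univ x y

/-- Real and imaginary parts `u`, `v` of an eigenvector of `iΩA` with eigenvalue `ν`. -/
theorem exists_of_mem_symplecticEigenvalues {m : Type*} [Fintype m] [DecidableEq m]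
    {A : Matrix (PhaseIdx m) (PhaseIdx m) ℝ} {ν : ℝ} (hν : ν ∈ symplecticEigenvalues A) :
    ∃ u v : PhaseIdx m → ℝ, ¬(u = 0 ∧ v = 0) ∧
      (symplecticForm m * A) *ᵥ u = ν • v ∧ (symplecticForm m * A) *ᵥ v = -(ν • u) := by
  obtain ⟨-, hmem⟩ := hν
  rw [spectrum.mem_iff, isUnit_iff_isUnit_det, isUnit_iff_ne_zero, not_not,
    ← exists_mulVec_eq_zero_iff] at hmem
  obtain ⟨w, hw0, hw⟩ := hmem
  have hww : w = fun i => (⟨(w i).re, (w i).im⟩ : ℂ) := by ext i; simp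
  refine ⟨fun i => (w i).re, fun i => (w i).im, fun ⟨h1, h2⟩ => hw0 ?_, ?_⟩
  · ext i
    exact Complex.ext (congrFun h1 i) (congrFun h2 i)
  · rw [hww, sub_mulVec, smul_mulVec, map_ofReal_mulVec, Algebra.algebraMap_eq_smul_one,
      smul_mulVec, one_mulVec] at hw
    constructor
    · ext i
      have := congrArg Complex.im (congrFun hw i)
      simp at this
      simp
      linarith
    · ext i
      have := congrArg Complex.re (congrFun hw i)
      simp at this
      simp
      linarith

/-- The symplectic eigenvalues `ν` of the partial transpose are at least the geometric mean of the
lower bounds on the two lowest eigenvalues of `π`. For an eigenvector `u + iv`, the forms of the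
partial transpose at `u` and at `v` both equal `-ν (u ⬝ Ω v)`, while `(u ⬝ Ω v)² ≤ ‖u‖² ‖v‖²`. -/
theorem sqrt_le_of_mem_symplecticEigenvalues
    {π : Matrix (PhaseIdx (Fin 2)) (PhaseIdx (Fin 2)) ℝ} {a b : ℝ} (ha : 0 < a) (hb : 0 < b)
    (h : HasLowBounds π a b) {ν : ℝ} (hν : ν ∈ symplecticEigenvalues (partialTranspose π)) :
    √(a * b) ≤ ν := by
  obtain ⟨u, v, huv, hu, hv⟩ := exists_of_mem_symplecticEigenvalues hν
  obtain ⟨e, he⟩ := h.secondLowest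
  set Ω := symplecticForm (Fin 2) with hΩ
  set M := Ω * partialTranspose π with hM
  -- Multiplying the eigenvector by a complex number makes its flipped imaginary part orthogonal
  -- to `e`, so that the better bound `b` applies to `v`.
  obtain ⟨u, v, huv, hu, hv, hve⟩ : ∃ u v : PhaseIdx (Fin 2) → ℝ, ¬(u = 0 ∧ v = 0) ∧
      M *ᵥ u = ν • v ∧ M *ᵥ v = -(ν • u) ∧ (momentumFlip *ᵥ v) ⬝ᵥ e = 0 := by
    set p := (momentumFlip *ᵥ u) ⬝ᵥ e with hp
    set q := (momentumFlip *ᵥ v) ⬝ᵥ e with hq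
    by_cases hq0 : q = 0
    · exact ⟨u, v, huv, hu, hv, hq0⟩
    refine ⟨p • u + q • v, p • v - q • u, fun ⟨h1, h2⟩ => huv ?_, ?_, ?_, ?_⟩
    · have hpq : p ^ 2 + q ^ 2 ≠ 0 := by positivity
      constructor
      · have : (p ^ 2 + q ^ 2) • u = p • (p • u + q • v) - q • (p • v - q • u) := by module
        rw [h1, h2, smul_zero, smul_zero, sub_zero] at this
        exact (smul_eq_zero.1 this).resolve_left hpq
      · have : (p ^ 2 + q ^ 2) • v = q • (p • u + q • v) + p • (p • v - q • u) := by module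
        rw [h1, h2, smul_zero, smul_zero, add_zero] at this
        exact (smul_eq_zero.1 this).resolve_left hpq
    · rw [mulVec_add, mulVec_smul, mulVec_smul, hu, hv]; module
    · rw [mulVec_sub, mulVec_smul, mulVec_smul, hu, hv]; module
    · rw [mulVec_sub, mulVec_smul, mulVec_smul, sub_dotProduct, smul_dotProduct, smul_dotProduct,
        ← hp, ← hq, smul_eq_mul, smul_eq_mul, mul_comm, sub_self]
  have hγ : partialTranspose π = -(Ω * M) := by
    have h1 : Ω * Ω = -1 := symplecticForm_mul_self
    rw [hM, ← mul_assoc, h1, neg_mul, one_mul, neg_neg]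
  have hform : ∀ x, x ⬝ᵥ (partialTranspose π *ᵥ x) =
      (momentumFlip *ᵥ x) ⬝ᵥ (π *ᵥ (momentumFlip *ᵥ x)) := fun x => by
    rw [← quadForm_congr, momentumFlip_transpose]; rfl
  have hnorm : ∀ x, (momentumFlip *ᵥ x) ⬝ᵥ (momentumFlip *ᵥ x) = x ⬝ᵥ x := fun x => by
    rw [dotProduct_mulVec_self, momentumFlip_transpose, momentumFlip_mul_self, one_mulVec]
  have hu2 := h.lowest (momentumFlip *ᵥ u) (dotProduct_zero _)
  have hv2 := he (momentumFlip *ᵥ v) hve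
  rw [hnorm, ← hform, hγ, neg_mulVec, ← mulVec_mulVec, hu, mulVec_smul, dotProduct_neg,
    dotProduct_smul, smul_eq_mul] at hu2
  rw [hnorm, ← hform, hγ, neg_mulVec, ← mulVec_mulVec, hv, mulVec_neg, mulVec_smul,
    dotProduct_neg, dotProduct_neg, neg_neg, dotProduct_smul, smul_eq_mul,
    dotProduct_comm v (Ω *ᵥ u), symplecticForm_mulVec_dotProduct] at hv2
  set k := u ⬝ᵥ (Ω *ᵥ v) with hk
  have hCS : k ^ 2 ≤ (u ⬝ᵥ u) * (v ⬝ᵥ v) := by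
    have h1 := dotProduct_sq_le u (Ω *ᵥ v)
    rwa [dotProduct_mulVec_self, hΩ, symplecticForm_transpose, neg_mul, symplecticForm_mul_self,
      neg_neg, one_mulVec] at h1
  have hu0 : 0 ≤ u ⬝ᵥ u := by simpa using dotProduct_star_self_nonneg u
  have hv0 : 0 ≤ v ⬝ᵥ v := by simpa using dotProduct_star_self_nonneg v
  have hk0 : k ≠ 0 := by
    intro h0
    rw [h0] at hu2 hv2
    refine huv ⟨dotProduct_self_eq_zero.1 ?_, dotProduct_self_eq_zero.1 ?_⟩ <;> nlinarith
  have hk2 : 0 < k ^ 2 := by positivity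
  have hmul : (a * (u ⬝ᵥ u)) * (b * (v ⬝ᵥ v)) ≤ -(ν * k) * (ν * -k) :=
    mul_le_mul hu2 hv2 (by positivity) (le_trans (by positivity) hu2)
  refine Real.sqrt_le_iff.2 ⟨hν.1, ?_⟩
  refine le_of_mul_le_mul_right (?_ : _ * k ^ 2 ≤ _ * k ^ 2) hk2
  calc a * b * k ^ 2 ≤ a * b * ((u ⬝ᵥ u) * (v ⬝ᵥ v)) := by gcongr
    _ ≤ ν ^ 2 * k ^ 2 := by linarith

end PartialTranspose

/-! ### The entropy function -/

section Entropy

theorem h_eq {x : ℝ} : h x = (((1 + x) ^ 2 / (4 * x)) * Real.log ((1 + x) ^ 2 / (4 * x)) -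
    ((1 - x) ^ 2 / (4 * x)) * Real.log ((1 - x) ^ 2 / (4 * x))) / Real.log 2 := by
  rw [h, Real.logb, Real.logb]
  ring

theorem h_one : h 1 = 0 := by norm_num [h]

theorem h_zero : h 0 = 0 := by simp [h]

theorem continuousOn_h : ContinuousOn h (Set.Ioi 0) := by
  have h1 : ContinuousOn (fun x : ℝ => (1 + x) ^ 2 / (4 * x)) (Set.Ioi 0) :=
    ContinuousOn.div (by fun_prop) (by fun_prop) fun x hx => by
      have : (0 : ℝ) < x := hx
      positivity
  have h2 : ContinuousOn (fun x : ℝ => (1 - x) ^ 2 / (4 * x)) (Set.Ioi 0) :=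
    ContinuousOn.div (by fun_prop) (by fun_prop) fun x hx => by
      have : (0 : ℝ) < x := hx
      positivity
  have h3 := ((Real.continuous_mul_log.comp_continuousOn h1).sub
    (Real.continuous_mul_log.comp_continuousOn h2)).div_const (Real.log 2)
  exact h3.congr fun x _ => h_eq

theorem monotoneOn_mul_log_succ_sub :
    MonotoneOn (fun t : ℝ => (t + 1) * Real.log (t + 1) - t * Real.log t) (Set.Ici 0) := by
  refine monotoneOn_of_deriv_nonneg (convex_Ici 0) ?_ ?_ ?_
  · exact ((Real.continuous_mul_log.comp (continuous_id.add continuous_const)).sub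
      Real.continuous_mul_log).continuousOn
  all_goals
    rw [interior_Ici]
    intro t ht
    have ht0 : (0 : ℝ) < t := ht
    have hd : HasDerivAt (fun t : ℝ => (t + 1) * Real.log (t + 1) - t * Real.log t)
        (Real.log (t + 1) + 1 - (Real.log t + 1)) t :=
      (HasDerivAt.comp_add_const t 1 (Real.hasDerivAt_mul_log (by positivity))).sub
        (Real.hasDerivAt_mul_log ht0.ne')
  · exact hd.differentiableAt.differentiableWithinAt
  · rw [hd.deriv]
    have := Real.log_le_log ht0 (by linarith : t ≤ t + 1)
    linarith

/-- With `t = (1 - x)² / (4x)`, which decreases on `(0, 1]`, `h x` is the increasing function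
`(t + 1) log₂ (t + 1) - t log₂ t`. -/
theorem antitoneOn_h : AntitoneOn h (Set.Ioc 0 1) := by
  intro x hx y hy hxy
  have hB : (1 - y) ^ 2 / (4 * y) ≤ (1 - x) ^ 2 / (4 * x) :=
    div_le_div₀ (sq_nonneg _) (by nlinarith [hx.2, hy.2]) (by linarith [hx.1]) (by linarith)
  have hsucc : ∀ z : ℝ, 0 < z → (1 + z) ^ 2 / (4 * z) = (1 - z) ^ 2 / (4 * z) + 1 := by
    intro z hz
    field_simp
    ring
  have hnn : ∀ z : ℝ, 0 < z → 0 ≤ (1 - z) ^ 2 / (4 * z) := fun z hz => by positivity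
  rw [h_eq, h_eq, hsucc x hx.1, hsucc y hy.1]
  exact div_le_div_of_nonneg_right
    (monotoneOn_mul_log_succ_sub (hnn y hy.1) (hnn x hx.1) hB) (Real.log_nonneg one_le_two)

theorem entanglementEntropy_le {π : Matrix (PhaseIdx (Fin 2)) (PhaseIdx (Fin 2)) ℝ} {a b : ℝ}
    (ha : 0 < a) (hab : a ≤ b) (hb : b ≤ 1) (hπ : HasLowBounds π a b) :
    entanglementEntropy π ≤ h √(a * b) := by
  have hc : √(a * b) ∈ Set.Ioc (0 : ℝ) 1 :=
    ⟨Real.sqrt_pos.2 (by nlinarith), Real.sqrt_le_one.2 (by nlinarith)⟩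
  have hnn : 0 ≤ h √(a * b) := by
    rw [← h_one]
    exact antitoneOn_h hc ⟨one_pos, le_rfl⟩ hc.2
  rw [entanglementEntropy]
  split_ifs with hlt
  · rw [lowestSymplecticEigenvalue] at hlt ⊢
    rcases (symplecticEigenvalues (partialTranspose π)).eq_empty_or_nonempty with he | hne
    -- The symplectic spectrum is never empty, but no proof of this is needed: the conventions give
    -- `h (sInf ∅) = h 0 = 0`.
    · rw [he, Real.sInf_empty, h_zero]
      exact hnn
    · have hle : √(a * b) ≤ sInf (symplecticEigenvalues (partialTranspose π)) :=
        le_csInf hne fun ν hν =>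
          sqrt_le_of_mem_symplecticEigenvalues ha (ha.trans_le hab) hπ hν
      exact antitoneOn_h hc ⟨hc.1.trans_le hle, hlt.le⟩ hle
  · exact hnn

end Entropy

/-! ### Vacuum ancillas and passive operations -/

section Dilation

variable {n : ℕ}

/-- The coordinate projection of the phase space of `n + 2` modes onto that of the first two. -/
def keepModes (n : ℕ) : Matrix (PhaseIdx (Fin 2)) (PhaseIdx (Fin 2 ⊕ Fin n)) ℝ :=
  (1 : Matrix (PhaseIdx (Fin 2 ⊕ Fin n)) (PhaseIdx (Fin 2 ⊕ Fin n)) ℝ).submatrix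
    (fun k => (Sum.inl k.1, k.2)) id

theorem traceOut_eq (A : Matrix (PhaseIdx (Fin 2 ⊕ Fin n)) (PhaseIdx (Fin 2 ⊕ Fin n)) ℝ) :
    traceOut A = keepModes n * A * (keepModes n)ᵀ := by
  ext i j
  simp [traceOut, keepModes, mul_apply, one_apply]

theorem keepModes_mul_transpose : keepModes n * (keepModes n)ᵀ = 1 := by
  have := traceOut_eq (n := n) 1
  rw [Matrix.mul_one] at this
  rw [← this]
  ext i j
  simp [traceOut, one_apply, Prod.ext_iff]

theorem keepModes_mul_apply {l : Type*} (A : Matrix (PhaseIdx (Fin 2 ⊕ Fin n)) l ℝ)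
    (k : PhaseIdx (Fin 2)) (j : l) : (keepModes n * A) k j = A (Sum.inl k.1, k.2) j := by
  simp [keepModes, mul_apply, one_apply]

theorem mul_keepModes_inl {l : Type*} (A : Matrix l (PhaseIdx (Fin 2)) ℝ)
    (i : l) (j t : Fin 2) : (A * keepModes n) i (Sum.inl j, t) = A i (j, t) := by
  simp [keepModes, mul_apply, one_apply, Fintype.sum_prod_type, ite_and]

theorem mul_keepModes_inr {l : Type*} (A : Matrix l (PhaseIdx (Fin 2)) ℝ)
    (i : l) (j : Fin n) (t : Fin 2) : (A * keepModes n) i (Sum.inr j, t) = 0 := by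
  simp [keepModes, mul_apply, one_apply]

theorem keepModes_mul_symplecticForm :
    keepModes n * symplecticForm (Fin 2 ⊕ Fin n) = symplecticForm (Fin 2) * keepModes n := by
  ext ⟨i, s⟩ ⟨j | j, t⟩
  · simp [keepModes_mul_apply, mul_keepModes_inl, symplecticForm, kroneckerMap_apply, one_apply]
  · simp [keepModes_mul_apply, mul_keepModes_inr, symplecticForm, kroneckerMap_apply]

/-- Adding vacuum modes is dilation along the coisometry `V = keepModes n`. In the form
`Vᵀ σ V + (1 - Vᵀ V)`, it preserves symplecticity if `V` intertwines the symplectic forms, and it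
preserves `HasLowBounds` with `a ≤ b ≤ 1`. -/
theorem withVacuum_eq (σ : Matrix (PhaseIdx (Fin 2)) (PhaseIdx (Fin 2)) ℝ) :
    withVacuum σ n = (keepModes n)ᵀ * σ * keepModes n + (1 - (keepModes n)ᵀ * keepModes n) := by
  have hV : ∀ (B : Matrix (PhaseIdx (Fin 2)) (PhaseIdx (Fin 2)) ℝ),
      (keepModes n)ᵀ * B * keepModes n = (fromBlocks B 0 0 0).submatrix
        (Equiv.sumProdDistrib (Fin 2) (Fin n) (Fin 2))
        (Equiv.sumProdDistrib (Fin 2) (Fin n) (Fin 2)) := by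
    intro B
    have hT : (keepModes n)ᵀ * B = (Bᵀ * keepModes n)ᵀ := by
      rw [transpose_mul, transpose_transpose]
    rw [hT]
    ext ⟨i | i, s⟩ ⟨j | j, t⟩ <;>
      simp [-transpose_mul, mul_keepModes_inl, mul_keepModes_inr]
  have h1 := hV 1
  rw [Matrix.mul_one] at h1
  rw [hV, h1, withVacuum]
  ext ⟨i | i, s⟩ ⟨j | j, t⟩ <;> simp [one_apply]

variable {m m' : Type*} [Fintype m] [DecidableEq m] [Fintype m'] [DecidableEq m']

theorem HasLowBounds.dilation {n k : Type*} [Fintype n] [Fintype k] [DecidableEq k]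
    [DecidableEq n] {V : Matrix n k ℝ} (hV : V * Vᵀ = 1) {A : Matrix n n ℝ} {a b : ℝ}
    (hab : a ≤ b) (hb : b ≤ 1) (hA : HasLowBounds A a b) :
    HasLowBounds (Vᵀ * A * V + (1 - Vᵀ * V)) a b := by
  have hbound : ∀ {r : ℝ} {e}, r ≤ 1 → FormBound A r e →
      FormBound (Vᵀ * A * V + (1 - Vᵀ * V)) r (Vᵀ *ᵥ e) := by
    intro r e hr h x hx
    have h1 := h (V *ᵥ x) (by rw [← hx, dotProduct_mulVec, vecMul_transpose])
    have hP : 0 ≤ x ⬝ᵥ x - (V *ᵥ x) ⬝ᵥ (V *ᵥ x) := by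
      have h2 : 0 ≤ ((1 - Vᵀ * V) *ᵥ x) ⬝ᵥ ((1 - Vᵀ * V) *ᵥ x) := by
        simpa using dotProduct_star_self_nonneg ((1 - Vᵀ * V) *ᵥ x)
      have h3 : (1 - Vᵀ * V)ᵀ * (1 - Vᵀ * V) = 1 - Vᵀ * V := by
        rw [transpose_sub, transpose_mul, transpose_transpose, transpose_one, Matrix.mul_sub,
          Matrix.mul_one, Matrix.sub_mul, Matrix.one_mul, Matrix.mul_assoc Vᵀ,
          ← Matrix.mul_assoc V, hV, Matrix.one_mul, sub_self, sub_zero]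
      rwa [dotProduct_mulVec_self, h3, sub_mulVec, one_mulVec, dotProduct_sub,
        ← dotProduct_mulVec_self] at h2
    rw [add_mulVec, sub_mulVec, one_mulVec, dotProduct_add, dotProduct_sub, quadForm_congr,
      ← dotProduct_mulVec_self]
    nlinarith [mul_nonneg (sub_nonneg.2 hr) hP]
  obtain ⟨e, he⟩ := hA.secondLowest
  exact ⟨by simpa using hbound (hab.trans hb) hA.lowest, _, hbound hb he⟩

theorem symplectic_dilation {V : Matrix (PhaseIdx m') (PhaseIdx m) ℝ} (hV : V * Vᵀ = 1)
    (hVΩ : V * symplecticForm m = symplecticForm m' * V)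
    {π : Matrix (PhaseIdx m') (PhaseIdx m') ℝ}
    (hπ : π * symplecticForm m' * π = symplecticForm m') :
    (Vᵀ * π * V + (1 - Vᵀ * V)) * symplecticForm m * (Vᵀ * π * V + (1 - Vᵀ * V)) =
      symplecticForm m := by
  have hVΩ' : symplecticForm m * Vᵀ = Vᵀ * symplecticForm m' := by
    have := congrArg transpose hVΩ
    simpa [symplecticForm_transpose] using this
  set P := 1 - Vᵀ * V with hP
  have hVP : V * P = 0 := by
    rw [hP, Matrix.mul_sub, Matrix.mul_one, ← Matrix.mul_assoc, hV, Matrix.one_mul, sub_self]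
  have hPV : P * Vᵀ = 0 := by
    rw [hP, Matrix.sub_mul, Matrix.one_mul, Matrix.mul_assoc, hV, Matrix.mul_one, sub_self]
  have hPP : P * P = P := by
    conv_lhs => rw [hP, Matrix.sub_mul, Matrix.one_mul, Matrix.mul_assoc, ← hP, hVP,
      Matrix.mul_zero, sub_zero]
  have hPΩ : P * symplecticForm m = symplecticForm m * P := by
    rw [hP, Matrix.sub_mul, Matrix.mul_sub, Matrix.one_mul, Matrix.mul_one, Matrix.mul_assoc, hVΩ,
      ← Matrix.mul_assoc, ← hVΩ', Matrix.mul_assoc]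
  have e1 : Vᵀ * π * V * symplecticForm m * (Vᵀ * π * V) = Vᵀ * V * symplecticForm m := by
    calc Vᵀ * π * V * symplecticForm m * (Vᵀ * π * V)
        = Vᵀ * π * (V * symplecticForm m) * Vᵀ * π * V := by simp only [Matrix.mul_assoc]
      _ = Vᵀ * π * symplecticForm m' * (V * Vᵀ) * π * V := by
          rw [hVΩ]; simp only [Matrix.mul_assoc]
      _ = Vᵀ * (π * symplecticForm m' * π) * V := by
          rw [hV, Matrix.mul_one]; simp only [Matrix.mul_assoc]
      _ = Vᵀ * V * symplecticForm m := by rw [hπ, Matrix.mul_assoc, ← hVΩ, Matrix.mul_assoc]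
  have e2 : P * symplecticForm m * (Vᵀ * π * V) = 0 := by
    rw [hPΩ, Matrix.mul_assoc, ← Matrix.mul_assoc P, ← Matrix.mul_assoc P, hPV]
    simp
  have e3 : Vᵀ * π * V * symplecticForm m * P = 0 := by
    rw [Matrix.mul_assoc _ _ P, ← hPΩ, ← Matrix.mul_assoc, Matrix.mul_assoc _ V P, hVP]
    simp
  have e4 : P * symplecticForm m * P = P * symplecticForm m := by
    rw [Matrix.mul_assoc, ← hPΩ, ← Matrix.mul_assoc, hPP]
  rw [Matrix.add_mul, Matrix.add_mul, Matrix.mul_add, Matrix.mul_add, e1, e2, e3, e4, add_zero,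
    zero_add, hP, ← Matrix.add_mul, add_sub_cancel, Matrix.one_mul]

theorem posDef_of_formBound {n : Type*} [Fintype n] {A : Matrix n n ℝ} (hA : Aᵀ = A) {a : ℝ}
    (ha : 0 < a) (h : FormBound A a 0) : A.PosDef := by
  refine .of_dotProduct_mulVec_pos (by simpa [IsHermitian] using hA) fun {x} hx => ?_
  have h1 : 0 < x ⬝ᵥ x := by simpa using dotProduct_star_self_pos_iff.2 hx
  have h2 := h x (dotProduct_zero x)
  rw [star_trivial]
  nlinarith

/-- A decomposition `σ = π + φ` bounds the entanglement of formation of every state that a passive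
operation makes out of `σ` and vacuum ancillas. -/
theorem entanglementOfFormation_le_of_isPure
    {π φ : Matrix (PhaseIdx (Fin 2)) (PhaseIdx (Fin 2)) ℝ} (hπ : IsPure π) (hφ : φ.PosSemidef)
    {K : Matrix (PhaseIdx (Fin 2 ⊕ Fin n)) (PhaseIdx (Fin 2 ⊕ Fin n)) ℝ} (hK : IsPassive K) :
    entanglementOfFormation (traceOut (K * withVacuum (π + φ) n * Kᵀ)) ≤
      (h (Real.exp (-pureSqueezing π hπ)) : EReal) := by
  obtain ⟨a, b, ha, hab, hb, hbd, hS⟩ := hπ.exists_hasLowBounds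
  set V := keepModes n with hVdef
  have hV : V * Vᵀ = 1 := keepModes_mul_transpose
  have hVΩ : V * symplecticForm (Fin 2 ⊕ Fin n) = symplecticForm (Fin 2) * V :=
    keepModes_mul_symplecticForm
  set Q := Vᵀ * π * V + (1 - Vᵀ * V) with hQdef
  have hQbd : HasLowBounds Q a b := hbd.dilation hV hab hb
  have hQs : Qᵀ = Q := by
    simp [hQdef, transpose_mul, isSymm_of_posDef hπ.posDef, Matrix.mul_assoc]
  have hKK : Kᵀ * K = 1 := mul_eq_one_comm.1 hK.orthogonal
  have hKΩ : K * symplecticForm (Fin 2 ⊕ Fin n) = symplecticForm (Fin 2 ⊕ Fin n) * K := by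
    conv_rhs => rw [← hK.symplectic, Matrix.mul_assoc, hKK, Matrix.mul_one]
  have hW : V * K * (V * K)ᵀ = 1 := by
    rw [transpose_mul, Matrix.mul_assoc, ← Matrix.mul_assoc K, hK.orthogonal, Matrix.one_mul, hV]
  have hWΩ : V * K * symplecticForm (Fin 2 ⊕ Fin n) = symplecticForm (Fin 2) * (V * K) := by
    calc V * K * symplecticForm (Fin 2 ⊕ Fin n) = V * (symplecticForm (Fin 2 ⊕ Fin n) * K) := by
          rw [Matrix.mul_assoc, hKΩ]
      _ = V * symplecticForm (Fin 2 ⊕ Fin n) * K := (Matrix.mul_assoc _ _ _).symm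
      _ = symplecticForm (Fin 2) * (V * K) := by rw [hVΩ, Matrix.mul_assoc]
  obtain ⟨π', hπ', hle, hbd'⟩ := exists_isPure_le_compression hW hWΩ
    (posDef_of_formBound hQs ha hQbd.lowest) (symplectic_dilation hV hVΩ hπ.symplectic) hQbd
  rw [hS]
  refine le_trans (sInf_le ⟨π', V * K * Q * (V * K)ᵀ - π' + (V * K * Vᵀ) * φ * (V * K * Vᵀ)ᴴ,
    hπ', hle.add (hφ.mul_mul_conjTranspose_same _), ?_, rfl⟩)
    (EReal.coe_le_coe_iff.2 (entanglementEntropy_le ha hab hb hbd'))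
  have hsum : withVacuum (π + φ) n = Q + Vᵀ * φ * V := by
    rw [withVacuum_eq, Matrix.mul_add, Matrix.add_mul, hQdef]
    abel
  rw [traceOut_eq, hsum, ← add_assoc, add_sub_cancel]
  simp only [conjTranspose_eq_transpose_of_trivial, transpose_mul, transpose_transpose,
    Matrix.mul_add, Matrix.add_mul, Matrix.mul_assoc, ← hVdef]

end Dilation

/-! ### The EoF-potential -/

section Potential

theorem pureSqueezing_nonneg {π : Matrix (PhaseIdx (Fin 2)) (PhaseIdx (Fin 2)) ℝ}
    (hπ : IsPure π) : 0 ≤ pureSqueezing π hπ := by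
  obtain ⟨a, b, ha, hab, hb, -, hS⟩ := hπ.exists_hasLowBounds
  have h1 : Real.exp (-pureSqueezing π hπ) ≤ 1 := by
    rw [hS]
    exact Real.sqrt_le_one.2 (by nlinarith)
  linarith [Real.exp_le_one_iff.1 h1]

theorem eofPotential_le {σ : Matrix (PhaseIdx (Fin 2)) (PhaseIdx (Fin 2)) ℝ}
    (hσ : IsGaussian σ) :
    eofPotential σ ≤ ((h (Real.exp (-squeezingOfFormation σ)) : ℝ) : EReal) := by
  refine sSup_le ?_
  rintro _ ⟨n, K, hK, rfl⟩
  set E := entanglementOfFormation (traceOut (K * withVacuum σ n * Kᵀ)) with hE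
  set D : Set ℝ := {s | ∃ (π φ : Matrix (PhaseIdx (Fin 2)) (PhaseIdx (Fin 2)) ℝ) (hπ : IsPure π),
    φ.PosSemidef ∧ σ = π + φ ∧ s = pureSqueezing π hπ} with hD
  have hne : D.Nonempty := by
    obtain ⟨π, hπ, hle⟩ := hσ.exists_isPure_le
    exact ⟨_, π, σ - π, hπ, hle, (add_sub_cancel _ _).symm, rfl⟩
  have hbdd : BddBelow D := by
    refine ⟨0, ?_⟩
    rintro _ ⟨π, φ, hπ, -, -, rfl⟩
    exact pureSqueezing_nonneg hπ
  have hsub : D ⊆ {s | E ≤ ((h (Real.exp (-s)) : ℝ) : EReal)} := by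
    rintro _ ⟨π, φ, hπ, hφ, hsum, rfl⟩
    simp only [hE, hsum]
    exact entanglementOfFormation_le_of_isPure hπ hφ hK
  have hcont : Continuous fun s : ℝ => ((h (Real.exp (-s)) : ℝ) : EReal) :=
    continuous_coe_real_ereal.comp
      (continuousOn_h.comp_continuous (by fun_prop) fun s => Real.exp_pos _)
  -- The infimum belongs to the closure of `D`, and the bound is a closed condition on `s`.
  exact closure_minimal hsub (isClosed_le continuous_const hcont) (csInf_mem_closure hne hbdd)

end Potential

end GaussianModes

theorem proposition1
    (σ : Matrix (GaussianModes.PhaseIdx (Fin 2)) (GaussianModes.PhaseIdx (Fin 2)) ℝ)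
    (hσ : GaussianModes.IsGaussian σ) :
    GaussianModes.eofPotential σ ≤
      ((GaussianModes.h (Real.exp (-GaussianModes.squeezingOfFormation σ)) : ℝ) : EReal) := by
  exact GaussianModes.eofPotential_le hσ
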